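/- Let $\mathfrak{Alg}$ be the category whose objects are the unital C*-algebras and whose morphisms $X\to Y$ are the operations, i.e. the unital completely positive linear maps $X\to Y$ (this class of morphisms is called $Op$). Let $hom$ be the subclass of injective unital $*$-homomorphisms. A $hom$-monomorphism is a morphism in $hom$ that is left cancellable with respect to morphisms in $hom$. Two $hom$-monomorphisms $f:D\to X$ and $f':D'\to X$ represent the same $hom$-subobject of $X$ if there is an isomorphism $e:D\to D'$ with $e,e^{-1}\in hom$, $f'\circ e=f$ and $f\circ e^{-1}=f'$. Operations $g_1:D_1\to X$, $g_2:D_2\to X$ are $Op$-independent if for all operations $\alpha_1:D_1\to D_1$ and $\alpha_2:D_2\to D_2$ there is an operation $\gamma:X\to X$ with $\gamma\circ g_1=g_1\circ\alpha_1$ and $\gamma\circ g_2=g_2\circ\alpha_2$. Two $hom$-subobjects of $X$ are $Op$-independent if all $hom$-monomorphisms $g_1,g_2$ representing them are $Op$-independent. Let $A$ and $B$ be nonzero unital C*-algebras, and let $A\otimes B$ be their minimal C*-tensor product, i.e. the completion of the algebraic tensor product in the norm $\|x\|=\sup_{\pi,\rho}\|(\pi\otimes\rho)(x)\|$, where $\pi$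 and $\rho$ run over the unital representations of $A$ and of $B$ on Hilbert spaces. **Proposition.** The canonical maps $\iota_A:A\to A\otimes B$, $a\mapsto a\otimes I$, and $\iota_B:B\to A\otimes B$, $b\mapsto I\otimes b$, are $hom$-monomorphisms, and the $hom$-subobjects $A\otimes I$ and $I\otimes B$ of $A\otimes B$ that they represent are $Op$-independent. Moreover, for all operations $\alpha:A\to A$ and $\beta:B\to B$ there is a unique operation $\gamma:A\otimes B\to A\otimes B$ with $\gamma(a\otimes b)=\alpha(a)\otimes\beta(b)$ for all $a\in A$, $b\in B$ (the tensor product of $\alpha$ and $\beta$), and it is a joint extension of $\alpha$ and $\beta$: $\gamma\circ\iota_A=\iota_A\circ\alpha$ and $\gamma\circ\iota_B=\iota_B\circ\beta$. -/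

import Mathlib

open scoped TensorProduct CStarAlgebra
open UniformSpace CategoryTheory

universe u v w

section MinimalTensorProduct

/-- A unital `*`-representation of a unital C⋆-algebra `A : Type u` on a complex Hilbert space in
the same universe. -/
structure HilbertRep (A : Type u) [CStarAlgebra A] where
  space : Type u
  [normedAddCommGroup : NormedAddCommGroup space]
  [innerProductSpace : InnerProductSpace ℂ space]
  [completeSpace : CompleteSpace space]
  hom : A →⋆ₐ[ℂ] (space →L[ℂ] space)

attribute [instance] HilbertRep.normedAddCommGroup HilbertRep.innerProductSpace
  HilbertRep.completeSpace

variable {A : Type u} {B : Type v} [CStarAlgebra A] [CStarAlgebra B]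

/-- The Hilbert space tensor product: the completion of the algebraic tensor product in the inner
product with `⟪x ⊗ y, x' ⊗ y'⟫ = ⟪x, x'⟫ * ⟪y, y'⟫`. -/
def HilbertTensor (H : Type u) (K : Type v) [NormedAddCommGroup H] [InnerProductSpace ℂ H]
    [NormedAddCommGroup K] [InnerProductSpace ℂ K] : Type (max u v) :=
  Completion (H ⊗[ℂ] K)

namespace HilbertTensor

variable {H : Type u} {K : Type v} [NormedAddCommGroup H]
    [InnerProductSpace ℂ H] [NormedAddCommGroup K] [InnerProductSpace ℂ K]

noncomputable instance : NormedAddCommGroup (HilbertTensor H K) :=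
  inferInstanceAs (NormedAddCommGroup (Completion (H ⊗[ℂ] K)))

noncomputable instance : InnerProductSpace ℂ (HilbertTensor H K) :=
  inferInstanceAs (InnerProductSpace ℂ (Completion (H ⊗[ℂ] K)))

instance : CompleteSpace (HilbertTensor H K) :=
  inferInstanceAs (CompleteSpace (Completion (H ⊗[ℂ] K)))

/-- The isometric embedding of the algebraic tensor product. -/
noncomputable def incl : H ⊗[ℂ] K →ₗᵢ[ℂ] HilbertTensor H K :=
  (Completion.toComplₗᵢ : H ⊗[ℂ] K →ₗᵢ[ℂ] Completion (H ⊗[ℂ] K))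

theorem denseRange_incl : DenseRange (incl : H ⊗[ℂ] K → HilbertTensor H K) :=
  Completion.denseRange_coe (α := H ⊗[ℂ] K)

/-- The bounded operator `S ⊗ T` on the Hilbert space tensor product. -/
noncomputable def map (S : H →L[ℂ] H) (T : K →L[ℂ] K) :
    HilbertTensor H K →L[ℂ] HilbertTensor H K :=
  (TensorProduct.mapL S T).completion

theorem map_incl (S : H →L[ℂ] H) (T : K →L[ℂ] K) (x : H ⊗[ℂ] K) :
    map S T (incl x) = incl (TensorProduct.mapL S T x) :=
  ContinuousLinearMap.completion_apply_coe _ _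

theorem clm_ext {f g : HilbertTensor H K →L[ℂ] HilbertTensor H K}
    (h : ∀ x : H ⊗[ℂ] K, f (incl x) = g (incl x)) : f = g :=
  DFunLike.coe_injective (denseRange_incl.equalizer f.continuous g.continuous (funext h))

theorem map_add_left (S S' : H →L[ℂ] H) (T : K →L[ℂ] K) :
    map (S + S') T = map S T + map S' T :=
  clm_ext fun x => by simp [map_incl, TensorProduct.mapL_add_left]

theorem map_add_right (S : H →L[ℂ] H) (T T' : K →L[ℂ] K) :
    map S (T + T') = map S T + map S T' :=
  clm_ext fun x => by simp [map_incl, TensorProduct.mapL_add_right]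

theorem map_smul_left (c : ℂ) (S : H →L[ℂ] H) (T : K →L[ℂ] K) :
    map (c • S) T = c • map S T :=
  clm_ext fun x => by simp [map_incl, TensorProduct.map_smul_left]

theorem map_smul_right (c : ℂ) (S : H →L[ℂ] H) (T : K →L[ℂ] K) :
    map S (c • T) = c • map S T :=
  clm_ext fun x => by simp [map_incl, TensorProduct.map_smul_right]

theorem map_mul (S S' : H →L[ℂ] H) (T T' : K →L[ℂ] K) :
    map (S * S') (T * T') = map S T * map S' T' :=
  clm_ext fun x => by
    change map (S * S') (T * T') (incl x) = map S T (map S' T' (incl x))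
    rw [map_incl, map_incl, map_incl, TensorProduct.mapL_mul]
    rfl

theorem map_one : map (1 : H →L[ℂ] H) (1 : K →L[ℂ] K) = 1 :=
  clm_ext fun x => (map_incl _ _ _).trans (congrArg _
    (DFunLike.congr_fun (TensorProduct.mapL_id_id (𝕜 := ℂ) (E := H) (G := K)) x))

theorem map_star [CompleteSpace H] [CompleteSpace K] (S : H →L[ℂ] H) (T : K →L[ℂ] K) :
    map (star S) (star T) = star (map S T) := by
  rw [ContinuousLinearMap.star_eq_adjoint (map S T), ContinuousLinearMap.eq_adjoint_iff]
  intro x y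
  induction x, y using denseRange_incl.induction_on₂ with
  | hp => apply isClosed_eq <;> fun_prop
  | h x y =>
    rw [map_incl, map_incl, LinearIsometry.inner_map_map, LinearIsometry.inner_map_map]
    induction x using TensorProduct.induction_on with
    | zero => simp
    | add x x' hx hx' => rw [_root_.map_add, inner_add_left, inner_add_left, hx, hx']
    | tmul a b =>
      induction y using TensorProduct.induction_on with
      | zero => simp
      | add y y' hy hy' => rw [_root_.map_add, inner_add_right, inner_add_right, hy, hy']
      | tmul c d =>
        rw [TensorProduct.mapL_tmul, TensorProduct.mapL_tmul, TensorProduct.inner_tmul,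
          TensorProduct.inner_tmul, ContinuousLinearMap.star_eq_adjoint,
          ContinuousLinearMap.star_eq_adjoint, ContinuousLinearMap.adjoint_inner_left,
          ContinuousLinearMap.adjoint_inner_left]

theorem norm_map_le (S : H →L[ℂ] H) (T : K →L[ℂ] K) : ‖map S T‖ ≤ ‖S‖ * ‖T‖ := by
  refine ContinuousLinearMap.opNorm_le_bound _ (by positivity) fun y => ?_
  induction y using denseRange_incl.induction_on with
  | hp => apply isClosed_le <;> fun_prop
  | ih y =>
    rw [map_incl, LinearIsometry.norm_map, LinearIsometry.norm_map]
    exact (ContinuousLinearMap.le_opNorm _ _).trans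
      (mul_le_mul_of_nonneg_right (TensorProduct.norm_mapL_le _ _) (norm_nonneg _))

end HilbertTensor

/-- The representation `π ⊗ ρ` of the algebraic tensor product `A ⊗ B` on the Hilbert space tensor
product, determined by `a ⊗ b ↦ π a ⊗ ρ b`. -/
noncomputable def HilbertRep.tensor (π : HilbertRep A) (ρ : HilbertRep B) :
    A ⊗[ℂ] B →ₐ[ℂ] (HilbertTensor π.space ρ.space →L[ℂ] HilbertTensor π.space ρ.space) :=
  Algebra.TensorProduct.algHomOfLinearMapTensorProduct
    (TensorProduct.lift (LinearMap.mk₂ ℂ (fun a b => HilbertTensor.map (π.hom a) (ρ.hom b))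
      (fun a a' b => by rw [map_add, HilbertTensor.map_add_left])
      (fun c a b => by rw [map_smul, HilbertTensor.map_smul_left])
      (fun a b b' => by rw [map_add, HilbertTensor.map_add_right])
      (fun c a b => by rw [map_smul, HilbertTensor.map_smul_right])))
    (fun a a' b b' => by simp [HilbertTensor.map_mul])
    (by simp [HilbertTensor.map_one])

@[simp]
theorem HilbertRep.tensor_tmul (π : HilbertRep A) (ρ : HilbertRep B) (a : A) (b : B) :
    π.tensor ρ (a ⊗ₜ b) = HilbertTensor.map (π.hom a) (ρ.hom b) := rfl

theorem HilbertRep.tensor_star (π : HilbertRep A) (ρ : HilbertRep B) (x : A ⊗[ℂ] B) :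
    π.tensor ρ (star x) = star (π.tensor ρ x) := by
  induction x using TensorProduct.induction_on with
  | zero => simp
  | tmul a b => simp [map_star, HilbertTensor.map_star]
  | add x y hx hy => rw [star_add, map_add, map_add, star_add, hx, hy]

/-- The minimal (spatial) C⋆-norm on the algebraic tensor product: the supremum of
`‖(π ⊗ ρ) x‖` over all representations `π` of `A` and `ρ` of `B`. -/
noncomputable def minNorm (x : A ⊗[ℂ] B) : ℝ :=
  ⨆ r : HilbertRep A × HilbertRep B, ‖r.1.tensor r.2 x‖

theorem minNorm_bddAbove (x : A ⊗[ℂ] B) :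
    BddAbove (Set.range fun r : HilbertRep A × HilbertRep B => ‖r.1.tensor r.2 x‖) := by
  suffices h : ∃ C : ℝ, ∀ r : HilbertRep A × HilbertRep B, ‖r.1.tensor r.2 x‖ ≤ C by
    obtain ⟨C, hC⟩ := h
    exact ⟨C, by rintro _ ⟨r, rfl⟩; exact hC r⟩
  induction x using TensorProduct.induction_on with
  | zero => exact ⟨0, fun r => by simp⟩
  | tmul a b =>
    refine ⟨‖a‖ * ‖b‖, fun r => ?_⟩
    rw [HilbertRep.tensor_tmul]
    exact (HilbertTensor.norm_map_le _ _).trans (mul_le_mul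
      (NonUnitalStarAlgHom.norm_apply_le (F := A →⋆ₐ[ℂ] _) r.1.hom a)
      (NonUnitalStarAlgHom.norm_apply_le (F := B →⋆ₐ[ℂ] _) r.2.hom b)
      (norm_nonneg _) (norm_nonneg _))
  | add x y hx hy =>
    obtain ⟨C, hC⟩ := hx
    obtain ⟨D, hD⟩ := hy
    refine ⟨C + D, fun r => ?_⟩
    rw [map_add]
    exact (norm_add_le _ _).trans (add_le_add (hC r) (hD r))

theorem norm_tensor_le_minNorm (π : HilbertRep A) (ρ : HilbertRep B) (x : A ⊗[ℂ] B) :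
    ‖π.tensor ρ x‖ ≤ minNorm x :=
  le_ciSup (minNorm_bddAbove x) (π, ρ)

theorem minNorm_nonneg (x : A ⊗[ℂ] B) : 0 ≤ minNorm x :=
  Real.iSup_nonneg fun _ => norm_nonneg _

theorem minNorm_le {x : A ⊗[ℂ] B} {C : ℝ} (hC : 0 ≤ C)
    (h : ∀ (π : HilbertRep A) (ρ : HilbertRep B), ‖π.tensor ρ x‖ ≤ C) : minNorm x ≤ C :=
  Real.iSup_le (fun r => h r.1 r.2) hC

theorem minNorm_mul_self_le (x : A ⊗[ℂ] B) : minNorm x * minNorm x ≤ minNorm (star x * x) := by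
  have h : minNorm x ≤ √(minNorm (star x * x)) := by
    refine minNorm_le (Real.sqrt_nonneg _) fun π ρ => Real.le_sqrt_of_sq_le ?_
    rw [sq, ← CStarRing.norm_star_mul_self, ← HilbertRep.tensor_star, ← map_mul]
    exact norm_tensor_le_minNorm _ _ _
  calc _ ≤ √(minNorm (star x * x)) * √(minNorm (star x * x)) :=
        mul_self_le_mul_self (minNorm_nonneg _) h
    _ = _ := Real.mul_self_sqrt (minNorm_nonneg _)

variable (A B) in
/-- The minimal C⋆-norm as a submultiplicative seminorm on the algebraic tensor product. -/
noncomputable def minRingSeminorm : RingSeminorm (A ⊗[ℂ] B) where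
  toFun := minNorm
  map_zero' := le_antisymm (minNorm_le le_rfl fun π ρ => by simp) (minNorm_nonneg _)
  add_le' x y := minNorm_le (add_nonneg (minNorm_nonneg _) (minNorm_nonneg _)) fun π ρ => by
    rw [map_add]
    exact (norm_add_le _ _).trans
      (add_le_add (norm_tensor_le_minNorm _ _ _) (norm_tensor_le_minNorm _ _ _))
  neg' x := by simp only [minNorm, map_neg, norm_neg]
  mul_le' x y := minNorm_le (mul_nonneg (minNorm_nonneg _) (minNorm_nonneg _)) fun π ρ => by
    rw [map_mul]
    exact (norm_mul_le _ _).trans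
      (mul_le_mul (norm_tensor_le_minNorm _ _ _) (norm_tensor_le_minNorm _ _ _)
        (norm_nonneg _) (minNorm_nonneg _))

variable (A B) in
/-- The algebraic tensor product `A ⊗ B` as a type of its own, carrying the minimal C⋆-norm. -/
def AlgTensor : Type (max u v) := A ⊗[ℂ] B

namespace AlgTensor

noncomputable instance : Ring (AlgTensor A B) := inferInstanceAs (Ring (A ⊗[ℂ] B))
noncomputable instance : Algebra ℂ (AlgTensor A B) := inferInstanceAs (Algebra ℂ (A ⊗[ℂ] B))
noncomputable instance : StarAddMonoid (AlgTensor A B) :=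
  inferInstanceAs (StarAddMonoid (A ⊗[ℂ] B))
instance : StarModule ℂ (AlgTensor A B) := inferInstanceAs (StarModule ℂ (A ⊗[ℂ] B))

/-- The identity map from the algebraic tensor product. -/
noncomputable def of : A ⊗[ℂ] B ≃ₐ[ℂ] AlgTensor A B := AlgEquiv.refl

noncomputable instance : SeminormedRing (AlgTensor A B) :=
  { (minRingSeminorm A B).toSeminormedRing with
    toRing := inferInstance }

theorem norm_of (x : A ⊗[ℂ] B) : ‖of x‖ = minNorm x := rfl

theorem of_star (x : A ⊗[ℂ] B) : of (star x) = star (of x) := rfl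

noncomputable instance : NormedAlgebra ℂ (AlgTensor A B) where
  norm_smul_le c x := by
    refine minNorm_le (mul_nonneg (norm_nonneg c) (minNorm_nonneg _)) fun π ρ => ?_
    refine (congrArg norm (map_smul (π.tensor ρ) c x)).trans_le ?_
    rw [norm_smul]
    exact mul_le_mul_of_nonneg_left (norm_tensor_le_minNorm _ _ _) (norm_nonneg _)

noncomputable instance : StarRing (AlgTensor A B) where
  star_add := star_add
  star_mul x y := by
    change star ((show A ⊗[ℂ] B from x) * (show A ⊗[ℂ] B from y)) =
      star (show A ⊗[ℂ] B from y) * star (show A ⊗[ℂ] B from x)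
    generalize (show A ⊗[ℂ] B from x) = x
    generalize (show A ⊗[ℂ] B from y) = y
    induction x using TensorProduct.induction_on with
    | zero => simp
    | add x x' hx hx' => rw [add_mul, star_add, star_add, mul_add, hx, hx']
    | tmul a b =>
      induction y using TensorProduct.induction_on with
      | zero => simp
      | add y y' hy hy' => rw [mul_add, star_add, star_add, add_mul, hy, hy']
      | tmul c d => simp

theorem norm_star_mul_self (x : AlgTensor A B) : ‖x‖ * ‖x‖ ≤ ‖star x * x‖ :=
  minNorm_mul_self_le x

theorem norm_star_le (x : AlgTensor A B) : ‖star x‖ ≤ ‖x‖ := by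
  refine minNorm_le (minNorm_nonneg _) fun π ρ => ?_
  refine (congrArg norm (HilbertRep.tensor_star π ρ x)).trans_le ?_
  rw [norm_star]
  exact norm_tensor_le_minNorm _ _ _

theorem norm_star (x : AlgTensor A B) : ‖star x‖ = ‖x‖ :=
  le_antisymm (norm_star_le x) (by simpa using norm_star_le (star x))

instance : NormedStarGroup (AlgTensor A B) where
  norm_star_le := norm_star_le

end AlgTensor

variable (A B) in
/-- The minimal C⋆-tensor product of `A` and `B`: the completion of the algebraic tensor product in
the minimal C⋆-norm. -/
def MinTensor : Type (max u v) := Completion (AlgTensor A B)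

namespace MinTensor

noncomputable instance : NormedRing (MinTensor A B) :=
  inferInstanceAs (NormedRing (Completion (AlgTensor A B)))

instance : CompleteSpace (MinTensor A B) :=
  inferInstanceAs (CompleteSpace (Completion (AlgTensor A B)))

noncomputable instance : Algebra ℂ (MinTensor A B) :=
  inferInstanceAs (Algebra ℂ (Completion (AlgTensor A B)))

noncomputable instance : NormedAlgebra ℂ (MinTensor A B) where
  norm_smul_le c x := norm_smul_le c (show Completion (AlgTensor A B) from x)

/-- The canonical homomorphism from the algebraic to the minimal tensor product. -/
noncomputable def incl : A ⊗[ℂ] B →ₐ[ℂ] MinTensor A B where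
  toFun x := ((AlgTensor.of x : AlgTensor A B) : Completion (AlgTensor A B))
  map_one' := rfl
  map_mul' x y := (congrArg _ (map_mul AlgTensor.of x y)).trans (Completion.coe_mul _ _)
  map_zero' := rfl
  map_add' x y := Completion.coe_add (AlgTensor.of x) (AlgTensor.of y)
  commutes' _ := rfl

theorem norm_incl (x : A ⊗[ℂ] B) : ‖(incl x : MinTensor A B)‖ = minNorm x :=
  Completion.norm_coe (AlgTensor.of x)

theorem denseRange_incl : DenseRange (incl : A ⊗[ℂ] B → MinTensor A B) :=
  Completion.denseRange_coe (α := AlgTensor A B)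

/-- The adjoint, extended by continuity from the algebraic tensor product. -/
noncomputable instance : Star (MinTensor A B) where
  star := Completion.map (star : AlgTensor A B → AlgTensor A B)

theorem uniformContinuous_star :
    UniformContinuous (star : AlgTensor A B → AlgTensor A B) :=
  (starNormedAddGroupHom (E := AlgTensor A B)).uniformContinuous

theorem continuous_star' : Continuous (star : MinTensor A B → MinTensor A B) :=
  Completion.continuous_map

theorem star_incl (x : A ⊗[ℂ] B) : star (incl x : MinTensor A B) = incl (star x) :=
  Completion.map_coe uniformContinuous_star (AlgTensor.of x)

noncomputable instance : StarRing (MinTensor A B) where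
  star_involutive x := by
    induction x using denseRange_incl.induction_on with
    | hp => exact isClosed_eq (continuous_star'.comp continuous_star') continuous_id
    | ih x => rw [star_incl, star_incl, star_star]
  star_mul x y := by
    induction x, y using denseRange_incl.induction_on₂ with
    | hp =>
      exact isClosed_eq (continuous_star'.comp continuous_mul)
        ((continuous_star'.comp continuous_snd).mul (continuous_star'.comp continuous_fst))
    | h x y =>
      rw [← map_mul, star_incl, star_incl, star_incl, ← map_mul]
      exact congrArg incl (star_mul (AlgTensor.of x) (AlgTensor.of y))
  star_add x y := by
    induction x, y using denseRange_incl.induction_on₂ with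
    | hp =>
      exact isClosed_eq (continuous_star'.comp continuous_add)
        ((continuous_star'.comp continuous_fst).add (continuous_star'.comp continuous_snd))
    | h x y => rw [← map_add, star_incl, star_incl, star_incl, ← map_add, star_add]

instance : StarModule ℂ (MinTensor A B) where
  star_smul c x := by
    induction x using denseRange_incl.induction_on with
    | hp =>
      exact isClosed_eq (continuous_star'.comp (continuous_const_smul c))
        (continuous_star'.const_smul (star c))
    | ih x => rw [← map_smul, star_incl, star_incl, ← map_smul, star_smul]

instance : CStarRing (MinTensor A B) where
  norm_mul_self_le x := by
    induction x using denseRange_incl.induction_on with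
    | hp =>
      exact isClosed_le (continuous_norm.mul continuous_norm)
        (continuous_norm.comp (continuous_star'.mul continuous_id))
    | ih x =>
      rw [star_incl, ← map_mul, norm_incl, norm_incl]
      exact AlgTensor.norm_star_mul_self (AlgTensor.of x)

noncomputable instance : CStarAlgebra (MinTensor A B) where

/-- The elementary tensor `a ⊗ b` in the minimal tensor product. -/
noncomputable def tmul (a : A) (b : B) : MinTensor A B := incl (a ⊗ₜ[ℂ] b)

variable (A B) in
/-- The canonical homomorphism `a ↦ a ⊗ 1`. -/
noncomputable def inl : A →⋆ₐ[ℂ] MinTensor A B where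
  __ := (incl : A ⊗[ℂ] B →ₐ[ℂ] MinTensor A B).comp Algebra.TensorProduct.includeLeft
  map_star' a := by
    change incl (star a ⊗ₜ[ℂ] (1 : B)) = star (incl (a ⊗ₜ[ℂ] (1 : B)))
    rw [star_incl, TensorProduct.star_tmul, star_one]

variable (A B) in
/-- The canonical homomorphism `b ↦ 1 ⊗ b`. -/
noncomputable def inr : B →⋆ₐ[ℂ] MinTensor A B where
  __ := (incl : A ⊗[ℂ] B →ₐ[ℂ] MinTensor A B).comp Algebra.TensorProduct.includeRight
  map_star' b := by
    change incl ((1 : A) ⊗ₜ[ℂ] star b) = star (incl ((1 : A) ⊗ₜ[ℂ] b))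
    rw [star_incl, TensorProduct.star_tmul, star_one]

theorem inl_apply (a : A) : inl A B a = tmul a 1 := rfl

theorem inr_apply (b : B) : inr A B b = tmul 1 b := rfl

end MinTensor

end MinimalTensorProduct

section Independence

variable {C : Type w} [Category.{v} C]

/-- `Mor`-independence of two morphisms `f : A ⟶ X` and `g : B ⟶ X`. -/
def MorIndependent {A B X : C} (f : A ⟶ X) (g : B ⟶ X) : Prop :=
  ∀ (α : A ⟶ A) (β : B ⟶ B), ∃ γ : X ⟶ X, f ≫ γ = α ≫ f ∧ g ≫ γ = β ≫ g

/-- For a subclass `W` of the morphisms: `f` is a `W`-monomorphism, that is, `f` belongs to `W` and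
is left cancellable with respect to morphisms of `W`. -/
def IsHomMono (W : MorphismProperty C) {A X : C} (f : A ⟶ X) : Prop :=
  W f ∧ ∀ ⦃Z : C⦄ (g h : Z ⟶ A), W g → W h → g ≫ f = h ≫ f → g = h

/-- Two morphisms into `X` represent the same `W`-subobject of `X`: there is a `W`-isomorphism
between their sources that carries one to the other. -/
def SameHomSubobject (W : MorphismProperty C) {A B X : C} (f : A ⟶ X) (g : B ⟶ X) : Prop :=
  ∃ e : A ≅ B, W e.hom ∧ W e.inv ∧ e.hom ≫ g = f ∧ e.inv ≫ f = g

/-- `f₁` and `f₂` are `W`-monomorphisms into `X`, and the two `W`-subobjects of `X` that they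
represent are `Mor`-independent: all their representatives are. -/
def HomSubobjectsIndependent (W : MorphismProperty C) {A B X : C} (f₁ : A ⟶ X) (f₂ : B ⟶ X) :
    Prop :=
  IsHomMono W f₁ ∧ IsHomMono W f₂ ∧
    ∀ ⦃D₁ D₂ : C⦄ (g₁ : D₁ ⟶ X) (g₂ : D₂ ⟶ X), IsHomMono W g₁ → IsHomMono W g₂ →
      SameHomSubobject W g₁ f₁ → SameHomSubobject W g₂ f₂ → MorIndependent g₁ g₂

end Independence

/-- Objects of the category `(Alg, Op)`: unital C⋆-algebras. -/
structure OpAlg where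
  carrier : Type u
  [cstarAlgebra : CStarAlgebra carrier]

namespace OpAlg

instance : CoeSort OpAlg.{u} (Type u) := ⟨OpAlg.carrier⟩

attribute [instance] OpAlg.cstarAlgebra

/-- The usual order on a C⋆-algebra, whose positive elements are those of the form `star a * a`. -/
noncomputable instance (X : OpAlg.{u}) : PartialOrder X := CStarAlgebra.spectralOrder X

instance (X : OpAlg.{u}) : StarOrderedRing X := CStarAlgebra.spectralOrderedRing X

/-- A (non-selective) operation: a unital completely positive linear map. -/
structure Operation (X Y : OpAlg.{u}) where
  toCP : X →CP Y
  map_one : toCP 1 = 1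

noncomputable instance (X Y : OpAlg.{u}) : FunLike (Operation X Y) X Y where
  coe f := f.toCP
  coe_injective f g h := by
    cases f
    cases g
    congr
    exact DFunLike.coe_injective h

/-- A unital `*`-homomorphism is an operation. -/
noncomputable def Operation.ofStarAlgHom {X Y : OpAlg.{u}} (φ : X →⋆ₐ[ℂ] Y) : Operation X Y where
  toCP := CompletelyPositiveMapClass.toCompletelyPositiveLinearMap φ
  map_one := _root_.map_one φ

/-- The composite of two operations. -/
noncomputable def Operation.comp {X Y Z : OpAlg.{u}} (g : Operation Y Z) (f : Operation X Y) :
    Operation X Z where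
  toCP :=
    { toLinearMap := (g.toCP : Y →ₗ[ℂ] Z) ∘ₗ (f.toCP : X →ₗ[ℂ] Y)
      map_cstarMatrix_nonneg' := fun k M hM =>
        g.toCP.map_cstarMatrix_nonneg' k _ (f.toCP.map_cstarMatrix_nonneg' k M hM) }
  map_one := (congrArg g.toCP f.map_one).trans g.map_one

noncomputable instance : Category.{u} OpAlg.{u} where
  Hom := Operation
  id X := Operation.ofStarAlgHom (StarAlgHom.id ℂ X)
  comp f g := Operation.comp g f

noncomputable instance (X Y : OpAlg.{u}) : FunLike (X ⟶ Y) X Y :=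
  inferInstanceAs (FunLike (Operation X Y) X Y)

@[simp] theorem id_apply (X : OpAlg.{u}) (x : X) : (𝟙 X : X ⟶ X) x = x := rfl

@[simp] theorem comp_apply {X Y Z : OpAlg.{u}} (f : X ⟶ Y) (g : Y ⟶ Z) (x : X) :
    (f ≫ g) x = g (f x) := rfl

@[simp] theorem ofStarAlgHom_apply {X Y : OpAlg.{u}} (φ : X →⋆ₐ[ℂ] Y) (x : X) :
    (show X ⟶ Y from Operation.ofStarAlgHom φ) x = φ x := rfl

@[ext] theorem hom_ext {X Y : OpAlg.{u}} {f g : X ⟶ Y} (h : ∀ x, f x = g x) : f = g :=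
  DFunLike.ext f g h

/-- The class `hom` of injective unital `*`-homomorphisms, as a subclass of the operations. -/
def injHom : MorphismProperty OpAlg.{u} := fun X Y f =>
  ∃ φ : X →⋆ₐ[ℂ] Y, Function.Injective φ ∧ ∀ x, f x = φ x

/-- The minimal C⋆-tensor product as an object of `(Alg, Op)`. -/
noncomputable def tensor (X Y : OpAlg.{u}) : OpAlg.{u} := ⟨MinTensor X Y⟩

/-- The elementary tensor `x ⊗ y` in the minimal tensor product. -/
noncomputable def tmul {X Y : OpAlg.{u}} (x : X) (y : Y) : tensor X Y :=
  (MinTensor.tmul x y : MinTensor X Y)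

/-- The canonical morphism `x ↦ x ⊗ 1`. -/
noncomputable def tensorInl (X Y : OpAlg.{u}) : X ⟶ tensor X Y :=
  Operation.ofStarAlgHom (MinTensor.inl X Y : X →⋆ₐ[ℂ] MinTensor X Y)

/-- The canonical morphism `y ↦ 1 ⊗ y`. -/
noncomputable def tensorInr (X Y : OpAlg.{u}) : Y ⟶ tensor X Y :=
  Operation.ofStarAlgHom (MinTensor.inr X Y : Y →⋆ₐ[ℂ] MinTensor X Y)

end OpAlg

/-! The joint extension of `α` and `β` is `α ⊗ β`, so the work is to show that this map on the
algebraic tensor product is contractive for the minimal norm and that its extension to the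
completion is completely positive. Independence of all representatives then follows by conjugating
with the isomorphisms of their sources, and uniqueness follows because elementary tensors span a
dense subspace.

Contractivity comes from a finite form of Stinespring's theorem (`HilbertRep.exists_dilation`): for
finitely many vectors `h i`, the coefficients of `π ∘ α` at these vectors are coefficients of one
representation `σ` of the source algebra. Dilating both factors turns a coefficient of `(π ⊗ ρ) ∘ (α
⊗ β)` at `u`, `v` into a coefficient of `σ ⊗ τ` at vectors of the same norms, and `σ ⊗ τ` is bounded
by `minNorm` by definition. Finite families suffice because algebraic tensors are dense in the
Hilbert tensor product.

Complete positivity is a Schur product argument: positive matrices are Gram matrices, and tensoring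
the Gram factorizations obtained from `α` and `β` factorizes the image of a Gram matrix of algebraic
tensors (`MinTensor.gram_map_nonneg`). Density gives the rest.

The canonical maps are injective because GNS representations separate points, so the minimal norm
does not vanish on nonzero elementary tensors. -/

section Representations

/-! ### Norming positive functionals and GNS representations. -/

open scoped ComplexOrder InnerProductSpace

/-- Every positive element of a unital C⋆-algebra attains its norm at a positive functional. -/
theorem PositiveLinearMap.exists_apply_eq_norm {A : Type*} [CStarAlgebra A] [PartialOrder A]
    [StarOrderedRing A] [Nontrivial A] {p : A} (hp : 0 ≤ p) :
    ∃ f : A →ₚ[ℂ] ℂ, f p = ‖p‖ := by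
  -- Norming `‖p‖ • 1 + p`, whose norm is `2‖p‖`, instead of `p` forces a contraction to be extremal
  -- at `1` and at `p` simultaneously.
  obtain ⟨g, hg, hgp⟩ := exists_dual_vector'' ℂ (algebraMap ℝ A ‖p‖ + p)
  have hre (x : A) : (g x).re ≤ ‖x‖ :=
    (Complex.re_le_norm _).trans ((g.le_opNorm x).trans (mul_le_of_le_one_left (norm_nonneg _) hg))
  have hnorm : ‖algebraMap ℝ A ‖p‖ + p‖ = ‖p‖ + ‖p‖ := by
    refine le_antisymm ((norm_add_le _ _).trans (by simp [norm_algebraMap'])) ?_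
    have h := spectrum.add_mem_add_iff (s := ‖p‖).mpr (CStarAlgebra.norm_mem_spectrum_of_nonneg hp)
    exact (le_abs_self _).trans (spectrum.norm_le_norm_of_mem h)
  have h1 : (g 1).re ≤ 1 := by simpa using hre 1
  have halg (r : ℝ) : g (algebraMap ℝ A r) = r * g 1 := by
    rw [Algebra.algebraMap_eq_smul_one, ← Complex.coe_smul, map_smul, smul_eq_mul]
  have hsum : ‖p‖ * (g 1).re + (g p).re = ‖p‖ + ‖p‖ := by
    have := congrArg Complex.re hgp
    simpa [halg, hnorm] using this
  have hpre : (g p).re = ‖p‖ := by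
    nlinarith [hre p, norm_nonneg p]
  have hg1 : ‖p‖ * (g 1).re = ‖p‖ := by linarith
  rcases eq_or_ne p 0 with rfl | hp0
  · exact ⟨0, by simp⟩
  replace hg1 : (g 1).re = 1 := by
    have := norm_pos_iff.mpr hp0
    nlinarith
  -- The Hermitian part of `g`, which is `Re g` on self-adjoint elements.
  let f₀ : A →ₗ[ℂ] ℂ :=
    { toFun := fun x => (g x + star (g (star x))) / 2
      map_add' := fun x y => by simp; ring
      map_smul' := fun c x => by simp; ring }
  have hf₀ {x : A} (hx : IsSelfAdjoint x) : f₀ x = (g x).re := by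
    change (g x + star (g (star x))) / 2 = _
    rw [hx.star_eq, Complex.star_def, Complex.add_conj]
    simp
  refine ⟨PositiveLinearMap.mk₀ f₀ fun x hx => ?_, ?_⟩
  · rw [hf₀ (.of_nonneg hx)]
    have h2 := hre (algebraMap ℝ A ‖x‖ - x)
    -- With `Re g 1 = 1`, evaluating the contraction `g` on `‖x‖ • 1 - x` gives `‖x‖ - Re g x ≤
    -- ‖x‖`, which is positivity.
    have h3 : ‖algebraMap ℝ A ‖x‖ - x‖ ≤ ‖x‖ := by
      refine (CStarAlgebra.norm_le_iff_le_algebraMap _ (norm_nonneg x) ?_).mpr ?_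
      · exact sub_nonneg.mpr (IsSelfAdjoint.of_nonneg hx).le_algebraMap_norm_self
      · exact sub_le_self _ hx
    simp [halg, hg1] at h2
    exact_mod_cast (by linarith : 0 ≤ (g x).re)
  · exact (hf₀ (.of_nonneg hp)).trans (by rw [hpre])

variable {A : Type u} [CStarAlgebra A]

/-- In the GNS representation of a positive `f` with `f (star a * a) = ‖star a * a‖`, the vector `ξ`
given by the class of `1` satisfies `‖π(a) ξ‖² = f (star a * a) = ‖a‖²`. -/
theorem HilbertRep.exists_apply_ne_zero [Nontrivial A] {a : A} (ha : a ≠ 0) :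
    ∃ (π : HilbertRep A) (x : π.space), π.hom a x ≠ 0 := by
  let _ : PartialOrder A := CStarAlgebra.spectralOrder A
  have _ : StarOrderedRing A := CStarAlgebra.spectralOrderedRing A
  obtain ⟨f, hf⟩ := PositiveLinearMap.exists_apply_eq_norm (star_mul_self_nonneg a)
  refine ⟨⟨f.GNS, f.gnsStarAlgHom⟩, (f.toPreGNS 1 : f.GNS), fun h => ha ?_⟩
  have h' : ‖((f.leftMulMapPreGNS a (f.toPreGNS 1) : f.PreGNS) : f.GNS)‖ = 0 := by
    rw [← f.gnsNonUnitalStarAlgHom_apply_coe, norm_eq_zero]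
    exact h
  rw [Completion.norm_coe] at h'
  have h2 := f.preGNS_norm_sq (f.leftMulMapPreGNS a (f.toPreGNS 1))
  rw [h'] at h2
  simp [hf, CStarRing.norm_star_mul_self] at h2
  exact h2

/-! ### Positive matrices as Gram matrices, and finite Stinespring dilations. -/

variable {A' : Type u} [CStarAlgebra A'] [PartialOrder A] [StarOrderedRing A] [PartialOrder A']
  [StarOrderedRing A']

theorem CStarAlgebra.exists_eq_star_mul_self {X : Type*} [CStarAlgebra X] [PartialOrder X]
    [StarOrderedRing X] {x : X} (hx : 0 ≤ x) : ∃ c, x = star c * c :=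
  CStarAlgebra.nonneg_iff_eq_star_mul_self.mp hx

theorem CStarMatrix.exists_gram_of_nonneg {ι : Type*} [Fintype ι] {M : CStarMatrix ι ι A}
    (hM : 0 ≤ M) : ∃ C : ι → ι → A, ∀ i j, M i j = ∑ k, star (C k i) * C k j := by
  classical
  obtain ⟨C, rfl⟩ := CStarAlgebra.exists_eq_star_mul_self hM
  exact ⟨C, fun i j => by simp [CStarMatrix.mul_apply, CStarMatrix.star_apply]⟩

theorem CStarMatrix.sum_apply {X m n κ : Type*} [AddCommMonoid X] (s : Finset κ)
    (M : κ → CStarMatrix m n X) (i : m) (j : n) : (∑ k ∈ s, M k) i j = ∑ k ∈ s, M k i j := by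
  classical
  induction s using Finset.induction_on with
  | empty => simp
  | insert a s ha ih => simp [Finset.sum_insert ha, ih]

theorem CStarMatrix.nonneg_of_gram {ι κ : Type*} [Fintype ι] [Fintype κ] (C : κ → ι → A) :
    0 ≤ (CStarMatrix.ofMatrix fun i j => ∑ k, star (C k i) * C k j : CStarMatrix ι ι A) := by
  classical
  have key (c : ι → A) :
      0 ≤ (CStarMatrix.ofMatrix fun i j => star (c i) * c j : CStarMatrix ι ι A) := by
    rcases isEmpty_or_nonempty ι with h | ⟨⟨i₀⟩⟩
    · exact (CStarMatrix.ext fun i => isEmptyElim i).le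
    · let E : CStarMatrix ι ι A := CStarMatrix.ofMatrix fun i j => if i = i₀ then c j else 0
      convert star_mul_self_nonneg E using 1
      ext i j
      rw [CStarMatrix.mul_apply]
      change star (c i) * c j = ∑ k, star (if k = i₀ then c i else 0) * if k = i₀ then c j else 0
      simp
  convert Finset.sum_nonneg fun k (_ : k ∈ Finset.univ) => key (C k) using 1
  ext i j
  rw [CStarMatrix.sum_apply]
  rfl

/-- The diagonal embedding of a C⋆-algebra into its matrices. -/
noncomputable def CStarMatrix.diagonalStarAlgHom (ι : Type*) [Fintype ι] [DecidableEq ι] (A : Type*)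
    [CStarAlgebra A] [PartialOrder A] [StarOrderedRing A] :
    A →⋆ₐ[ℂ] CStarMatrix ι ι A where
  toFun a := CStarMatrix.ofMatrix (Matrix.diagonal fun _ => a)
  map_one' := Matrix.diagonal_one
  map_mul' a b := (Matrix.diagonal_mul_diagonal (fun _ => a) (fun _ => b)).symm
  map_zero' := Matrix.diagonal_zero
  map_add' a b := (Matrix.diagonal_add (fun _ => a) (fun _ => b)).symm
  commutes' _ := rfl
  map_star' a := (Matrix.diagonal_conjTranspose (fun _ => a)).symm

/-- A Stinespring dilation of `π ∘ α` over a finite family of vectors. -/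
theorem HilbertRep.exists_dilation (α : A →CP A') (π : HilbertRep A') {ι : Type u} [Fintype ι]
    (h : ι → π.space) : ∃ (σ : HilbertRep A) (η : ι → σ.space), ∀ i j a,
      ⟪η i, σ.hom a (η j)⟫_ℂ = ⟪h i, π.hom (α a) (h j)⟫_ℂ := by
  classical
  -- The GNS space of this functional on matrices is the dilation space, with `A` acting through
  -- diagonal matrices.
  let Φ₀ : CStarMatrix ι ι A →ₗ[ℂ] ℂ :=
    { toFun := fun M => ∑ i, ∑ j, ⟪h i, π.hom (α (M i j)) (h j)⟫_ℂ
      map_add' := fun M N => by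
        simp [Finset.sum_add_distrib]
      map_smul' := fun c M => by
        simp [Finset.mul_sum] }
  have hΦ (M : CStarMatrix ι ι A) (hM : 0 ≤ M) : 0 ≤ Φ₀ M := by
    obtain ⟨C, hC⟩ := CStarMatrix.exists_gram_of_nonneg (α.map_cstarMatrix_nonneg M hM)
    -- Factoring `α(M)` as a Gram matrix turns `Φ₀ M` into a sum of squared norms; this is where
    -- complete positivity enters.
    have : Φ₀ M = ∑ k, ⟪∑ i, π.hom (C k i) (h i), ∑ j, π.hom (C k j) (h j)⟫_ℂ := by
      change ∑ i, ∑ j, ⟪h i, π.hom (α (M i j)) (h j)⟫_ℂ = _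
      have hC' (i j : ι) : ⟪h i, π.hom (α (M i j)) (h j)⟫_ℂ =
          ∑ k, ⟪π.hom (C k i) (h i), π.hom (C k j) (h j)⟫_ℂ := by
        rw [show α (M i j) = _ from hC i j]
        simp only [map_sum, map_mul, map_star, sum_apply, inner_sum, mul_apply_eq_comp,
          ContinuousLinearMap.star_eq_adjoint, ContinuousLinearMap.adjoint_inner_right]
      simp only [hC', sum_inner, inner_sum]
      rw [Finset.sum_congr rfl fun i _ => Finset.sum_comm
        (f := fun j k => ⟪π.hom (C k i) (h i), π.hom (C k j) (h j)⟫_ℂ)]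
      exact Finset.sum_comm.trans (Finset.sum_congr rfl fun _ _ => Finset.sum_comm)
    rw [this]
    exact Finset.sum_nonneg fun k _ => by
      rw [inner_self_eq_norm_sq_to_K]
      exact pow_nonneg (by simp) 2
  let Φ : CStarMatrix ι ι A →ₚ[ℂ] ℂ := PositiveLinearMap.mk₀ Φ₀ hΦ
  -- The matrix unit in column `i` of a fixed row: by proof irrelevance the chosen row does not
  -- depend on `i`. Hence `star (E i) * diag(a) * E j` has the single entry `a` at `(i, j)`.
  let E (i : ι) : CStarMatrix ι ι A :=
    CStarMatrix.ofMatrix (Matrix.single (Classical.choice ⟨i⟩) i 1)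
  refine ⟨⟨Φ.GNS, Φ.gnsStarAlgHom.comp (CStarMatrix.diagonalStarAlgHom ι A)⟩,
    fun i => (Φ.toPreGNS (E i) : Φ.GNS), fun i j a => ?_⟩
  change ⟪(Φ.toPreGNS (E i) : Φ.GNS), Φ.gnsNonUnitalStarAlgHom
    (CStarMatrix.diagonalStarAlgHom ι A a) (Φ.toPreGNS (E j) : Φ.GNS)⟫_ℂ = _
  rw [Φ.gnsNonUnitalStarAlgHom_apply_coe, Completion.inner_coe, Φ.preGNS_inner_def]
  change Φ₀ (star (E i) * (CStarMatrix.diagonalStarAlgHom ι A a * E j)) = _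
  have hE : star (E i) * (CStarMatrix.diagonalStarAlgHom ι A a * E j) =
      CStarMatrix.ofMatrix (Matrix.single i j a) := by
    let F (i : ι) : Matrix ι ι A := Matrix.single (Classical.choice ⟨i⟩) i 1
    have : (F i).conjTranspose * ((Matrix.diagonal fun _ => a) * F j) = Matrix.single i j a := by
      simp only [F, Matrix.conjTranspose_single, star_one]
      ext i' j'
      simp [Matrix.mul_apply, Matrix.single_apply, Matrix.diagonal_apply, ite_and]
      split_ifs <;> rfl
    exact congrArg CStarMatrix.ofMatrix this
  rw [hE]
  have hs (i' j' : ι) : ⟪h i', π.hom (α ((Matrix.single i j a : Matrix ι ι A) i' j')) (h j')⟫_ℂ =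
      if i = i' then if j = j' then ⟪h i', π.hom (α a) (h j')⟫_ℂ else 0 else 0 := by
    rw [Matrix.single_apply]
    split_ifs <;> simp_all
  exact (Finset.sum_congr rfl fun _ _ => Finset.sum_congr rfl fun _ _ => hs _ _).trans (by simp)

end Representations

/-! ### Contractivity of `α ⊗ β` for the minimal norm. -/

section TensorOperations

open scoped InnerProductSpace

namespace HilbertRep

variable {A B A' B' : Type u} [CStarAlgebra A] [CStarAlgebra B] [CStarAlgebra A'] [CStarAlgebra B']

/-- Matrix coefficients of `(π ⊗ ρ) ∘ (α ⊗ β)` agree with those of `σ ⊗ τ` as soon as this holds in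
each factor. -/
theorem inner_tensor_map (α : A →ₗ[ℂ] A') (β : B →ₗ[ℂ] B') {π : HilbertRep A'} {ρ : HilbertRep B'}
    {σ : HilbertRep A} {τ : HilbertRep B} {ι : Type*} {h : ι → π.space} {k : ι → ρ.space}
    {η : ι → σ.space} {ζ : ι → τ.space}
    (hη : ∀ i j a, ⟪η i, σ.hom a (η j)⟫_ℂ = ⟪h i, π.hom (α a) (h j)⟫_ℂ)
    (hζ : ∀ i j b, ⟪ζ i, τ.hom b (ζ j)⟫_ℂ = ⟪k i, ρ.hom (β b) (k j)⟫_ℂ)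
    (s t : Finset ι) (x : A ⊗[ℂ] B) :
    ⟪HilbertTensor.incl (∑ i ∈ s, η i ⊗ₜ[ℂ] ζ i),
      σ.tensor τ x (HilbertTensor.incl (∑ j ∈ t, η j ⊗ₜ[ℂ] ζ j))⟫_ℂ =
    ⟪HilbertTensor.incl (∑ i ∈ s, h i ⊗ₜ[ℂ] k i),
      π.tensor ρ (TensorProduct.map α β x) (HilbertTensor.incl (∑ j ∈ t, h j ⊗ₜ[ℂ] k j))⟫_ℂ := by
  induction x using TensorProduct.induction_on with
  | zero => simp
  | add x y hx hy => simp only [map_add, add_apply, inner_add_right, hx, hy]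
  | tmul a b =>
    rw [TensorProduct.map_tmul, tensor_tmul, tensor_tmul, HilbertTensor.map_incl,
      HilbertTensor.map_incl, LinearIsometry.inner_map_map, LinearIsometry.inner_map_map]
    simp only [map_sum, sum_inner, inner_sum, TensorProduct.mapL_tmul, TensorProduct.inner_tmul,
      hη, hζ]

variable [PartialOrder A] [StarOrderedRing A] [PartialOrder A'] [StarOrderedRing A']
  [PartialOrder B] [StarOrderedRing B] [PartialOrder B'] [StarOrderedRing B']

/-- Every coefficient of the left-hand operator at algebraic tensors is a coefficient of some `σ ⊗
τ` at `x`, between vectors of unchanged norm, and Cauchy–Schwarz applies. -/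
theorem norm_tensor_map_le (α : A →CP A') (β : B →CP B') (hα : α 1 = 1) (hβ : β 1 = 1)
    (π : HilbertRep A') (ρ : HilbertRep B') (x : A ⊗[ℂ] B) :
    ‖π.tensor ρ (TensorProduct.map α.toLinearMap β.toLinearMap x)‖ ≤ minNorm x := by
  classical
  set T := π.tensor ρ (TensorProduct.map α.toLinearMap β.toLinearMap x)
  suffices key : ∀ u v : π.space ⊗[ℂ] ρ.space,
      ‖⟪HilbertTensor.incl u, T (HilbertTensor.incl v)⟫_ℂ‖ ≤
        minNorm x * ‖HilbertTensor.incl u‖ * ‖HilbertTensor.incl v‖ by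
    refine ContinuousLinearMap.opNorm_le_bound _ (minNorm_nonneg x) fun w => ?_
    have key' (y w) : ‖⟪y, T w⟫_ℂ‖ ≤ minNorm x * ‖y‖ * ‖w‖ := by
      induction y, w using HilbertTensor.denseRange_incl.induction_on₂ with
      | hp => apply isClosed_le <;> fun_prop
      | h u v => exact key u v
    rcases (norm_nonneg (T w)).eq_or_lt with h | h
    · rw [← h]
      exact mul_nonneg (minNorm_nonneg x) (norm_nonneg w)
    -- Test the form bound against `y = T w` and cancel one factor `‖T w‖`.
    · refine le_of_mul_le_mul_left ?_ h
      have := key' (T w) w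
      rw [inner_self_eq_norm_sq_to_K] at this
      simp only [norm_pow, RCLike.norm_ofReal, abs_norm] at this
      linarith
  intro u v
  obtain ⟨S, hS⟩ := TensorProduct.exists_finset u
  obtain ⟨S', hS'⟩ := TensorProduct.exists_finset v
  -- Dilating over the union of the two supports places `u` and `v` in the same pair of
  -- representations.
  obtain ⟨σ, η, hη⟩ := π.exists_dilation α fun i : ↥(S ∪ S') => i.1.1
  obtain ⟨τ, ζ, hζ⟩ := ρ.exists_dilation β fun i : ↥(S ∪ S') => i.1.2
  have hsub {R : Finset (π.space × ρ.space)} (hR : R ⊆ S ∪ S') :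
      ∑ i ∈ R.subtype (· ∈ S ∪ S'), i.1.1 ⊗ₜ[ℂ] i.1.2 = ∑ i ∈ R, i.1 ⊗ₜ[ℂ] i.2 := by
    rw [← Finset.sum_subtype_of_mem (fun i => i.1 ⊗ₜ[ℂ] i.2) hR]
  have hcoef := inner_tensor_map α.toLinearMap β.toLinearMap hη hζ
  have hnorm (s : Finset ↥(S ∪ S')) : ‖HilbertTensor.incl (∑ i ∈ s, η i ⊗ₜ[ℂ] ζ i)‖ =
      ‖HilbertTensor.incl (∑ i ∈ s, i.1.1 ⊗ₜ[ℂ] i.1.2)‖ := by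
    -- At `x = 1`, unitality of `α` and `β` makes the coefficient identity an equality of squared
    -- norms.
    have := hcoef s s 1
    rw [Algebra.TensorProduct.one_def, TensorProduct.map_tmul, show α.toLinearMap 1 = 1 from hα,
      show β.toLinearMap 1 = 1 from hβ, ← Algebra.TensorProduct.one_def, map_one,
      ← Algebra.TensorProduct.one_def, map_one, one_apply_eq_self,
      one_apply_eq_self, inner_self_eq_norm_sq_to_K, inner_self_eq_norm_sq_to_K] at this
    exact (sq_eq_sq₀ (norm_nonneg _) (norm_nonneg _)).mp (by exact_mod_cast this)
  have huv := hcoef (S.subtype _) (S'.subtype _) x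
  rw [hS, hS', ← hsub Finset.subset_union_left, ← hsub Finset.subset_union_right, ← huv, ← hnorm,
    ← hnorm]
  calc _ ≤ _ := norm_inner_le_norm _ _
    _ ≤ _ := mul_le_mul_of_nonneg_left ((ContinuousLinearMap.le_opNorm _ _).trans
      (mul_le_mul_of_nonneg_right (norm_tensor_le_minNorm σ τ x) (norm_nonneg _))) (norm_nonneg _)
    _ = _ := by ring

end HilbertRep

end TensorOperations

namespace MinTensor

/-! ### Injectivity of the canonical maps. -/

section Injectivity

variable {A : Type u} {B : Type v} [CStarAlgebra A] [CStarAlgebra B] [Nontrivial A] [Nontrivial B]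

/-- Choose vectors with `π(a) x ≠ 0` and `ρ(b) y ≠ 0`; the norm of `π(a) x ⊗ ρ(b) y` is the product
of their norms, and `π ⊗ ρ` is dominated by the minimal norm. -/
theorem tmul_ne_zero {a : A} {b : B} (ha : a ≠ 0) (hb : b ≠ 0) : tmul a b ≠ 0 := by
  obtain ⟨π, x, hx⟩ := HilbertRep.exists_apply_ne_zero ha
  obtain ⟨ρ, y, hy⟩ := HilbertRep.exists_apply_ne_zero hb
  intro h
  have h0 : π.tensor ρ (a ⊗ₜ b) = 0 := by
    rw [← norm_le_zero_iff, ← norm_zero (E := MinTensor A B), ← h, tmul, norm_incl]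
    exact norm_tensor_le_minNorm π ρ _
  have h1 : ‖HilbertTensor.map (π.hom a) (ρ.hom b) (HilbertTensor.incl (x ⊗ₜ y))‖ = 0 := by
    rw [← HilbertRep.tensor_tmul, h0]
    simp
  rw [HilbertTensor.map_incl, LinearIsometry.norm_map, TensorProduct.mapL_tmul,
    TensorProduct.norm_tmul] at h1
  exact (mul_ne_zero (norm_ne_zero_iff.mpr hx) (norm_ne_zero_iff.mpr hy)) h1

theorem inl_injective : Function.Injective (inl A B) :=
  (injective_iff_map_eq_zero _).mpr fun a h => by
    by_contra ha
    exact tmul_ne_zero ha one_ne_zero h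

theorem inr_injective : Function.Injective (inr A B) :=
  (injective_iff_map_eq_zero _).mpr fun b h => by
    by_contra hb
    exact tmul_ne_zero one_ne_zero hb h

end Injectivity

/-! ### Extension of `α ⊗ β` to the completion, and its complete positivity. -/

section TensorMap

variable {A B A' B' : Type u} [CStarAlgebra A] [CStarAlgebra B] [CStarAlgebra A'] [CStarAlgebra B']
  [PartialOrder A] [StarOrderedRing A] [PartialOrder A'] [StarOrderedRing A']
  [PartialOrder B] [StarOrderedRing B] [PartialOrder B'] [StarOrderedRing B']

/-- The tensor product of two unital completely positive maps, extended by continuity from the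
algebraic tensor product. -/
noncomputable def mapCLM (α : A →CP A') (β : B →CP B') : MinTensor A B →L[ℂ] MinTensor A' B' :=
  (incl.toLinearMap ∘ₗ TensorProduct.map α.toLinearMap β.toLinearMap).extendOfNorm
    (incl : A ⊗[ℂ] B →ₐ[ℂ] MinTensor A B).toLinearMap

/-- Contractivity, with constant `1`, supplies the bound under which `extendOfNorm` really extends
the algebraic map. -/
theorem mapCLM_incl {α : A →CP A'} {β : B →CP B'} (hα : α 1 = 1) (hβ : β 1 = 1) (x : A ⊗[ℂ] B) :
    mapCLM α β (incl x) = incl (TensorProduct.map α.toLinearMap β.toLinearMap x) :=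
  LinearMap.extendOfNorm_eq (f := incl.toLinearMap ∘ₗ _) (e := incl.toLinearMap) denseRange_incl
    ⟨1, fun x => by
      rw [one_mul]
      change ‖incl _‖ ≤ ‖incl x‖
      rw [norm_incl, norm_incl]
      exact minNorm_le (minNorm_nonneg x) fun π ρ =>
        HilbertRep.norm_tensor_map_le α β hα hβ π ρ x⟩ x

/-- The tensor product of two completely positive maps sends Gram matrices to positive matrices. -/
theorem gram_map_nonneg [PartialOrder (MinTensor A' B')] [StarOrderedRing (MinTensor A' B')]
    (α : A →CP A') (β : B →CP B') {ι : Type*} [Fintype ι] (x : ι → A ⊗[ℂ] B) :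
    0 ≤ (CStarMatrix.ofMatrix fun i j => incl (TensorProduct.map α.toLinearMap β.toLinearMap
      (star (x i) * x j)) : CStarMatrix ι ι (MinTensor A' B')) := by
  choose S hS using fun i => TensorProduct.exists_finset (x i)
  -- All elementary summands of all the `x i`, indexed disjointly so that each remembers its `i`.
  let P : Type _ := Σ i, ↥(S i)
  let a (p : P) : A := p.2.1.1
  let b (p : P) : B := p.2.1.2
  have hx (i : ι) : x i = ∑ r : ↥(S i), a ⟨i, r⟩ ⊗ₜ[ℂ] b ⟨i, r⟩ := by
    rw [hS, ← Finset.sum_coe_sort]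
  -- The matrix `star (a p) * a q` is a Gram matrix with one row, hence positive, so `α` sends it to
  -- a Gram matrix.
  obtain ⟨c, hc⟩ := CStarMatrix.exists_gram_of_nonneg (α.map_cstarMatrix_nonneg _
    (CStarMatrix.nonneg_of_gram fun _ : Unit => a))
  obtain ⟨d, hd⟩ := CStarMatrix.exists_gram_of_nonneg (β.map_cstarMatrix_nonneg _
    (CStarMatrix.nonneg_of_gram fun _ : Unit => b))
  replace hc (p q : P) : α.toLinearMap (star (a p) * a q) = ∑ k, star (c k p) * c k q := by
    rw [← hc p q]
    exact congrArg α (Fintype.sum_unique fun _ : Unit => star (a p) * a q).symm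
  replace hd (p q : P) : β.toLinearMap (star (b p) * b q) = ∑ k, star (d k p) * d k q := by
    rw [← hd p q]
    exact congrArg β (Fintype.sum_unique fun _ : Unit => star (b p) * b q).symm
  -- Tensoring the two factorizations gives Gram rows `c k ⊗ d l` indexed by pairs; summing over the
  -- summands of each `x i` returns to the index set `ι`. The remaining calculation only reorders
  -- finite sums.
  convert CStarMatrix.nonneg_of_gram fun (kl : P × P) i =>
    (incl (∑ r : ↥(S i), c kl.1 ⟨i, r⟩ ⊗ₜ[ℂ] d kl.2 ⟨i, r⟩) : MinTensor A' B') using 2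
  ext i j
  simp only [hx, star_incl, ← map_mul, star_sum, TensorProduct.star_tmul, Finset.sum_mul,
    Finset.mul_sum,
    Algebra.TensorProduct.tmul_mul_tmul, map_sum, TensorProduct.map_tmul, hc, hd,
    TensorProduct.sum_tmul, TensorProduct.tmul_sum, Fintype.sum_prod_type]
  calc _ = _ := Finset.sum_congr rfl fun _ _ => Finset.sum_congr rfl fun _ _ => Finset.sum_comm
    _ = _ := Finset.sum_congr rfl fun _ _ => Finset.sum_comm
    _ = _ := Finset.sum_comm
    _ = _ := Finset.sum_congr rfl fun _ _ => Finset.sum_congr rfl fun _ _ => Finset.sum_comm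
    _ = _ := Finset.sum_congr rfl fun _ _ => Finset.sum_comm

/-- Writing `M = star N * N` and approximating `N`, not `M`, by matrices of algebraic tensors
preserves positivity along the approximation. The condition on `N` is closed, since the positive
cone is closed and the entrywise map is continuous. -/
theorem mapCLM_cstarMatrix_nonneg [PartialOrder (MinTensor A B)] [StarOrderedRing (MinTensor A B)]
    [PartialOrder (MinTensor A' B')] [StarOrderedRing (MinTensor A' B')]
    {α : A →CP A'} {β : B →CP B'} (hα : α 1 = 1) (hβ : β 1 = 1) {ι : Type*} [Fintype ι]
    {M : CStarMatrix ι ι (MinTensor A B)} (hM : 0 ≤ M) : 0 ≤ M.map (mapCLM α β) := by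
  classical
  obtain ⟨N, rfl⟩ := CStarAlgebra.exists_eq_star_mul_self hM
  clear hM
  have hmap : Continuous fun M : CStarMatrix ι ι (MinTensor A B) => M.map (mapCLM α β) :=
    continuous_pi fun i => continuous_pi fun j =>
      (mapCLM α β).continuous.comp ((continuous_apply j).comp (continuous_apply i))
  have hdense : DenseRange fun N : ι → ι → A ⊗[ℂ] B =>
      (CStarMatrix.ofMatrix fun i j => incl (N i j) : CStarMatrix ι ι (MinTensor A B)) :=
    DenseRange.piMap fun _ => DenseRange.piMap fun _ => denseRange_incl
  induction N using hdense.induction_on with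
  | hp =>
    exact CStarAlgebra.isClosed_nonneg.preimage
      (hmap.comp (continuous_star.mul continuous_id))
  | ih N =>
    -- `star N * N` is the sum of the Gram matrices of the single rows of `N`.
    convert Finset.sum_nonneg fun k (_ : k ∈ Finset.univ) => gram_map_nonneg α β (N k) using 1
    ext i j
    rw [CStarMatrix.sum_apply, CStarMatrix.map_apply, CStarMatrix.mul_apply, map_sum]
    refine Finset.sum_congr rfl fun k _ => ?_
    rw [CStarMatrix.star_apply]
    change mapCLM α β (star (incl (N k i)) * incl (N k j)) = _
    rw [star_incl, ← map_mul, mapCLM_incl hα hβ]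
    rfl

end TensorMap

end MinTensor

/-! ### Independence and the choice of representatives. -/

section

variable {C : Type w} [Category.{v} C]

/-- Conjugating `α` and `β` by the isomorphisms of the sources transports them to endomorphisms of
`A` and `B`, and the resulting `γ` on `X` serves unchanged. -/
theorem MorIndependent.of_sameHomSubobject {W : MorphismProperty C} {A B D₁ D₂ X : C} {f₁ : A ⟶ X}
    {f₂ : B ⟶ X} {g₁ : D₁ ⟶ X} {g₂ : D₂ ⟶ X} (h : MorIndependent f₁ f₂)
    (h₁ : SameHomSubobject W g₁ f₁) (h₂ : SameHomSubobject W g₂ f₂) : MorIndependent g₁ g₂ := by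
  obtain ⟨e₁, -, -, rfl, -⟩ := h₁
  obtain ⟨e₂, -, -, rfl, -⟩ := h₂
  intro α β
  obtain ⟨γ, hγ₁, hγ₂⟩ := h (e₁.inv ≫ α ≫ e₁.hom) (e₂.inv ≫ β ≫ e₂.hom)
  exact ⟨γ, by simp [hγ₁], by simp [hγ₂]⟩

end

/-! ### The tensor product of operations in the category. -/

namespace OpAlg

theorem isHomMono_of_injective {X Y : OpAlg.{u}} (φ : X →⋆ₐ[ℂ] Y) (hφ : Function.Injective φ) :
    IsHomMono injHom (show X ⟶ Y from Operation.ofStarAlgHom φ) :=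
  ⟨⟨φ, hφ, fun _ => rfl⟩, fun _ _ _ _ _ h => hom_ext fun z => hφ (congrArg (fun k => k z) h)⟩

/-- The tensor product of two operations. -/
noncomputable def tensorMap {A B A' B' : OpAlg.{u}} (α : A ⟶ A') (β : B ⟶ B') :
    tensor A B ⟶ tensor A' B' :=
  show Operation (tensor A B) (tensor A' B') from
  { toCP :=
      { toLinearMap := (MinTensor.mapCLM (Operation.toCP α) (Operation.toCP β)).toLinearMap
        map_cstarMatrix_nonneg' := fun _ _ hM =>
          letI : PartialOrder (MinTensor A B) := inferInstanceAs (PartialOrder (tensor A B))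
          haveI : StarOrderedRing (MinTensor A B) := inferInstanceAs (StarOrderedRing (tensor A B))
          letI : PartialOrder (MinTensor A' B') := inferInstanceAs (PartialOrder (tensor A' B'))
          haveI : StarOrderedRing (MinTensor A' B') :=
            inferInstanceAs (StarOrderedRing (tensor A' B'))
          MinTensor.mapCLM_cstarMatrix_nonneg (Operation.map_one α) (Operation.map_one β) hM }
    map_one := (MinTensor.mapCLM_incl (Operation.map_one α) (Operation.map_one β) 1).trans <|
      congrArg MinTensor.incl <| (TensorProduct.map_tmul _ _ _ _).trans <|
        congrArg₂ _ (Operation.map_one α) (Operation.map_one β) }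

theorem tensorMap_tmul {A B A' B' : OpAlg.{u}} (α : A ⟶ A') (β : B ⟶ B') (a : A) (b : B) :
    tensorMap α β (tmul a b) = tmul (α a) (β b) :=
  (MinTensor.mapCLM_incl (Operation.map_one α) (Operation.map_one β) (a ⊗ₜ b)).trans
    (congrArg _ (TensorProduct.map_tmul _ _ _ _))

/-- Operations are automatically continuous, and elementary tensors span a dense subspace. -/
theorem tensor_hom_ext {A B X : OpAlg.{u}} {γ γ' : tensor A B ⟶ X}
    (h : ∀ a b, γ (tmul a b) = γ' (tmul a b)) : γ = γ' := by
  refine DFunLike.coe_injective (MinTensor.denseRange_incl.equalizer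
    (map_continuous (Operation.toCP γ)) (map_continuous (Operation.toCP γ')) (funext fun x => ?_))
  induction x using TensorProduct.induction_on with
  | zero =>
    simp only [Function.comp_apply, map_zero]
    exact (map_zero (Operation.toCP γ)).trans (map_zero (Operation.toCP γ')).symm
  | tmul a b => exact h a b
  | add x y hx hy =>
    simp only [Function.comp_apply] at hx hy ⊢
    rw [map_add]
    exact (map_add (Operation.toCP γ) _ _).trans
      ((congrArg₂ _ hx hy).trans (map_add (Operation.toCP γ') _ _).symm)

variable {A B A' B' : OpAlg.{u}} (α : A ⟶ A') (β : B ⟶ B')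

theorem apply_one {X Y : OpAlg.{u}} (f : X ⟶ Y) : f 1 = 1 := Operation.map_one f

theorem tensorInl_comp_tensorMap : tensorInl A B ≫ tensorMap α β = α ≫ tensorInl A' B' :=
  hom_ext fun a => (tensorMap_tmul α β a 1).trans (congrArg (tmul (α a)) (apply_one β))

theorem tensorInr_comp_tensorMap : tensorInr A B ≫ tensorMap α β = β ≫ tensorInr A' B' :=
  hom_ext fun b => (tensorMap_tmul α β 1 b).trans (congrArg (tmul · (β b)) (apply_one α))

end OpAlg

theorem mainTheorem2 (A B : OpAlg.{u}) [Nontrivial A] [Nontrivial B] :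
    HomSubobjectsIndependent OpAlg.injHom (OpAlg.tensorInl A B) (OpAlg.tensorInr A B) ∧
    ∀ (α : A ⟶ A) (β : B ⟶ B),
      ∃ γ : OpAlg.tensor A B ⟶ OpAlg.tensor A B,
        (∀ (a : A) (b : B), γ (OpAlg.tmul a b) = OpAlg.tmul (α a) (β b)) ∧
        (∀ γ' : OpAlg.tensor A B ⟶ OpAlg.tensor A B,
          (∀ (a : A) (b : B), γ' (OpAlg.tmul a b) = OpAlg.tmul (α a) (β b)) → γ' = γ) ∧
        OpAlg.tensorInl A B ≫ γ = α ≫ OpAlg.tensorInl A B ∧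
        OpAlg.tensorInr A B ≫ γ = β ≫ OpAlg.tensorInr A B := by
  have hind : MorIndependent (OpAlg.tensorInl A B) (OpAlg.tensorInr A B) := fun α β =>
    ⟨OpAlg.tensorMap α β, OpAlg.tensorInl_comp_tensorMap α β, OpAlg.tensorInr_comp_tensorMap α β⟩
  exact ⟨⟨OpAlg.isHomMono_of_injective _ MinTensor.inl_injective,
      OpAlg.isHomMono_of_injective _ MinTensor.inr_injective,
      fun _ _ _ _ _ _ h₁ h₂ => hind.of_sameHomSubobject h₁ h₂⟩,
    fun α β => ⟨OpAlg.tensorMap α β, OpAlg.tensorMap_tmul α β,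
      fun _ h => OpAlg.tensor_hom_ext fun a b => (h a b).trans (OpAlg.tensorMap_tmul α β a b).symm,
      OpAlg.tensorInl_comp_tensorMap α β, OpAlg.tensorInr_comp_tensorMap α β⟩⟩
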